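/- Let $(X,d)$ be a complete separable metric space with a non-negative Borel measure $m$ that is finite on bounded sets, let $Y$ be a separable $\mathrm{CAT}(0)$ space (complete, geodesic, with triangles no fatter than their Euclidean comparison triangles), let $\Omega\subset X$ be open and $u\colon\Omega\to Y$ Borel. *Tangent cones.* For $y\in Y$ let $\mathrm{Geo}_yY$ be the set of constant speed geodesics starting from $y$ and defined on some interval $[0,\varepsilon]$, $\varepsilon>0$, with the pseudodistance $d_y(\gamma,\eta)=\limsup_{t\downarrow0}d_Y(\gamma_t,\eta_t)/t$. The tangent cone $(T_yY,d_y)$ is the completion of $\mathrm{Geo}_yY/\{d_y=0\}$; $\gamma'_0$ is the class of $\gamma$ and $0_y$ that of the constant geodesic. Multiplication by $\lambda\ge0$ is induced by $(\gamma_t)\mapsto(\gamma_{\lambda t})$, $|v|_y=d_y(v,0_y)$, and $\langle v,w\rangle_y=\frac12(|v|_y^2+|w|_y^2-d_y(v,w)^2)$. Let $G_y^z$ be the unique geodesic on $[0,1]$ from $y$ to $z$. *Bundles.* On $T_GY=\{(y,v): y\in Y,\ v\in T_yY\}$ let $\mathcal B(T_GY)$ be the smallest $\sigma$-algebra making the projection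 to $Y$ and all the maps $(y,v)\mapsto\langle v,(G_y^z)'_0\rangle_y$, $z\in Y$, measurable. The set $u^*T_GY=\{(x,y,v): x\in\Omega,\ y=u(x),\ v\in T_yY\}\subset X\times T_GY$ carries the restriction of $\mathcal B(X)\otimes\mathcal B(T_GY)$. A section of $u^*T_GY$ is a map $x\mapsto(x,u(x),S_x)$ on $\Omega$ with $S_x\in T_{u(x)}Y$; it is Borel if it is measurable for these $\sigma$-algebras. *The space $L^2(u^*T_GY,m|_\Omega)$.* For sections $S,T$ put $d_{L^2}(S,T)=\big(\int_\Omega d_{u(x)}(S_x,T_x)^2\,dm\big)^{1/2}\in[0,\infty]$. Let $\mathcal L^2(u^*T_GY,m|_\Omega)$ be the set of sections $S$ such that (i) for all $\alpha\ge0$ and all Borel, essentially separably valued $v\colon\Omega\to Y$ the function $x\mapsto d_{u(x)}\big(S_x,\alpha(G_{u(x)}^{v(x)})'_0\big)$ is Borel, and (ii) there are $\alpha_n\ge0$ and Borel, essentially separably valued $v_n\colon\Omega\to Y$ such that the sections $S^n_x=\alpha_n(G_{u(x)}^{v_n(x)})'_0$ satisfy $\sup_n d_{L^2}(S^n,0)<\infty$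 and $d_{u(x)}(S^n_x,S_x)\to0$ for every $x\in\Omega$. Then $L^2(u^*T_GY,m|_\Omega)$ is the quotient of $\mathcal L^2(u^*T_GY,m|_\Omega)$ by the relation $d_{L^2}(S,T)=0$. **Claim.** The map sending the class in $L^2(u^*T_GY,m|_\Omega)$ of $S\in\mathcal L^2(u^*T_GY,m|_\Omega)$ to the equivalence class of $S$ up to $m$-a.e. equality is (well defined and) injective, and its image consists exactly of the $m$-a.e. equivalence classes of Borel sections $T$ of $u^*T_GY$ with $\int_\Omega|T_x|^2_{u(x)}\,dm(x)<\infty$. -/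

import Mathlib

open MeasureTheory Topology Filter Set
open scoped NNReal ENNReal

namespace GeomTangent

/-! ### Geodesics and complete CAT(0) spaces -/

/-- A (minimizing, constant speed) geodesic on `[0,1]`; values outside `[0,1]` are irrelevant. -/
def IsGeodesic {Y : Type*} [MetricSpace Y] (γ : ℝ → Y) : Prop :=
  ∀ s ∈ Icc (0 : ℝ) 1, ∀ t ∈ Icc (0 : ℝ) 1, dist (γ t) (γ s) = |t - s| * dist (γ 0) (γ 1)

/-- A complete geodesic metric space in which every point `d` intermediate between `b` and `c`
satisfies the comparison inequality with the Euclidean plane. (Comparison points always exist and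
are unique up to isometries of the plane.) -/
class CAT0Space (Y : Type*) [MetricSpace Y] : Prop where
  complete : CompleteSpace Y
  exists_geodesic : ∀ y z : Y, ∃ γ : ℝ → Y, IsGeodesic γ ∧ γ 0 = y ∧ γ 1 = z
  comparison : ∀ (a b c d : Y) (a' b' c' d' : EuclideanSpace ℝ (Fin 2)),
    dist b d + dist d c = dist b c →
    dist a' b' = dist a b → dist b' c' = dist b c → dist c' a' = dist c a →
    dist d' b' = dist d b → dist d' c' = dist d c →
    dist a d ≤ dist a' d'

/-! ### The tangent cone -/

/-- Constant speed geodesics emanating from `y` and defined on some right neighbourhood of `0`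
(values outside of that neighbourhood are irrelevant: they do not affect the pseudodistance). -/
structure Geo {Y : Type*} [MetricSpace Y] (y : Y) where
  toFun : ℝ → Y
  map_zero : toFun 0 = y
  isGeodesic : ∃ ε > 0, ∃ k : ℝ, 0 ≤ k ∧ ∀ s ∈ Icc (0 : ℝ) ε, ∀ t ∈ Icc (0 : ℝ) ε,
    dist (toFun t) (toFun s) = |t - s| * k

namespace Geo

variable {Y : Type*} [MetricSpace Y] {y : Y}

/-- The difference quotient `d(γ_t, η_t) / t`. -/
noncomputable def quot (γ η : Geo y) (t : ℝ) : ℝ := dist (γ.toFun t) (η.toFun t) / t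

/-- `d_y(γ, η) = limsup_{t ↓ 0} d(γ_t, η_t) / t`. -/
noncomputable instance : Dist (Geo y) where
  dist γ η := limsup (quot γ η) (𝓝[>] (0 : ℝ))

theorem dist_def (γ η : Geo y) : dist γ η = limsup (quot γ η) (𝓝[>] (0 : ℝ)) := rfl

theorem quot_nonneg (γ η : Geo y) : ∀ᶠ t in 𝓝[>] (0 : ℝ), 0 ≤ quot γ η t := by
  filter_upwards [self_mem_nhdsWithin] with t ht
  exact div_nonneg dist_nonneg (le_of_lt ht)

theorem eventually_dist_le (γ : Geo y) :
    ∃ k : ℝ, ∀ᶠ t in 𝓝[>] (0 : ℝ), dist (γ.toFun t) y ≤ k * t := by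
  obtain ⟨ε, hε, k, -, h⟩ := γ.isGeodesic
  refine ⟨k, ?_⟩
  filter_upwards [Ioo_mem_nhdsGT hε] with t ht
  have := h 0 ⟨le_rfl, hε.le⟩ t ⟨ht.1.le, ht.2.le⟩
  rw [γ.map_zero, sub_zero, abs_of_pos ht.1] at this
  rw [this, mul_comm]

theorem isBoundedUnder_quot (γ η : Geo y) :
    IsBoundedUnder (· ≤ ·) (𝓝[>] (0 : ℝ)) (quot γ η) := by
  obtain ⟨k, hk⟩ := γ.eventually_dist_le
  obtain ⟨l, hl⟩ := η.eventually_dist_le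
  refine ⟨k + l, ?_⟩
  rw [eventually_map]
  filter_upwards [hk, hl, self_mem_nhdsWithin] with t h1 h2 ht
  rw [quot, div_le_iff₀ ht]
  have := dist_triangle_right (γ.toFun t) (η.toFun t) y
  linarith

theorem isCoboundedUnder_quot (γ η : Geo y) :
    IsCoboundedUnder (· ≤ ·) (𝓝[>] (0 : ℝ)) (quot γ η) :=
  IsBoundedUnder.isCoboundedUnder_le ⟨0, by
    rw [eventually_map]; exact quot_nonneg γ η⟩

theorem dist_le_of_eventually {γ η : Geo y} {b : ℝ}
    (h : ∀ᶠ t in 𝓝[>] (0 : ℝ), quot γ η t ≤ b) : dist γ η ≤ b :=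
  limsup_le_of_le (isCoboundedUnder_quot γ η) h

theorem eventually_of_dist_lt {γ η : Geo y} {b : ℝ} (h : dist γ η < b) :
    ∀ᶠ t in 𝓝[>] (0 : ℝ), quot γ η t < b :=
  eventually_lt_of_limsup_lt h (isBoundedUnder_quot γ η)

theorem dist_nonneg' (γ η : Geo y) : 0 ≤ dist γ η := by
  by_contra h
  obtain ⟨t, h1, h2⟩ := ((eventually_of_dist_lt (not_le.1 h)).and (quot_nonneg γ η)).exists
  linarith

noncomputable instance : PseudoMetricSpace (Geo y) where
  dist_self γ := by
    refine le_antisymm (dist_le_of_eventually (Eventually.of_forall fun t => ?_))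
      (dist_nonneg' γ γ)
    simp [quot]
  dist_comm γ η := by
    simp only [dist_def]
    congr 1
    funext t
    simp only [quot, dist_comm]
  dist_triangle γ η ζ := by
    refine le_of_forall_pos_le_add fun δ hδ => dist_le_of_eventually ?_
    filter_upwards [eventually_of_dist_lt (show dist γ η < dist γ η + δ / 2 by linarith),
      eventually_of_dist_lt (show dist η ζ < dist η ζ + δ / 2 by linarith),
      self_mem_nhdsWithin] with t h1 h2 ht
    have h3 : quot γ ζ t ≤ quot γ η t + quot η ζ t := by
      simp only [quot]
      rw [← add_div]
      exact div_le_div_of_nonneg_right (dist_triangle _ _ _) (le_of_lt ht)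
    linarith

/-- The steady geodesic at `y`. -/
instance : Zero (Geo y) where
  zero := ⟨fun _ => y, rfl, 1, one_pos, 0, le_rfl, by simp⟩

/-- Multiplication by `c ≥ 0`: the reparametrization `t ↦ γ_{c t}`. -/
instance : SMul ℝ≥0 (Geo y) where
  smul c γ :=
    { toFun := fun t => γ.toFun (c * t)
      map_zero := by rw [mul_zero, γ.map_zero]
      isGeodesic := by
        obtain ⟨ε, hε, k, hk, h⟩ := γ.isGeodesic
        have hc : (0 : ℝ) < c + 1 := by positivity
        have key : ∀ s ∈ Icc (0 : ℝ) (ε / (c + 1)), (c : ℝ) * s ∈ Icc (0 : ℝ) ε := by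
          intro s hs
          refine ⟨mul_nonneg c.2 hs.1, ?_⟩
          have := (le_div_iff₀ hc).1 hs.2
          nlinarith [hs.1]
        refine ⟨ε / (c + 1), div_pos hε hc, c * k, mul_nonneg c.2 hk, fun s hs t ht => ?_⟩
        rw [h _ (key s hs) _ (key t ht), ← mul_sub, abs_mul, NNReal.abs_eq]
        ring }

theorem smul_toFun (c : ℝ≥0) (γ : Geo y) (t : ℝ) : (c • γ).toFun t = γ.toFun (c * t) := rfl

theorem lipschitzWith_smul (c : ℝ≥0) : LipschitzWith c (fun γ : Geo y => c • γ) := by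
  refine LipschitzWith.of_dist_le_mul fun γ η => ?_
  rcases eq_or_lt_of_le c.2 with hc | hc
  · have h0 : (c : ℝ) = 0 := hc.symm
    rw [h0, zero_mul]
    refine dist_le_of_eventually (Eventually.of_forall fun t => ?_)
    simp [quot, smul_toFun, h0, γ.map_zero, η.map_zero]
  · replace hc : (0 : ℝ) < c := hc
    refine le_of_forall_pos_le_add fun δ hδ => dist_le_of_eventually ?_
    have hlim : Tendsto (fun t : ℝ => (c : ℝ) * t) (𝓝[>] 0) (𝓝[>] 0) := by
      refine tendsto_nhdsWithin_iff.2 ⟨?_, ?_⟩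
      · have : Tendsto (fun t : ℝ => (c : ℝ) * t) (𝓝 0) (𝓝 ((c : ℝ) * 0)) :=
          (continuous_const.mul continuous_id).tendsto 0
        rw [mul_zero] at this
        exact this.mono_left nhdsWithin_le_nhds
      · filter_upwards [self_mem_nhdsWithin] with t ht
        exact mul_pos hc ht
    filter_upwards [hlim.eventually (eventually_of_dist_lt
      (show dist γ η < dist γ η + δ / c by linarith [div_pos hδ hc])),
      self_mem_nhdsWithin] with t h ht
    have ht' : (0 : ℝ) < t := ht
    have h1 : quot (c • γ) (c • η) t = c * quot γ η (c * t) := by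
      simp only [quot, smul_toFun]
      field_simp
    rw [h1]
    have h2 := mul_le_mul_of_nonneg_left h.le hc.le
    have h3 : (c : ℝ) * (dist γ η + δ / c) = c * dist γ η + δ := by field_simp
    linarith

end Geo

/-- The tangent cone `T_y Y`: the metric completion of `Geo y` modulo `d_y = 0` (the Hausdorff
completion of a pseudometric space performs both steps). -/
def TangentCone {Y : Type*} [MetricSpace Y] (y : Y) : Type _ := UniformSpace.Completion (Geo y)

namespace TangentCone

variable {Y : Type*} [MetricSpace Y] {y : Y}

noncomputable instance : MetricSpace (TangentCone y) :=
  inferInstanceAs (MetricSpace (UniformSpace.Completion (Geo y)))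

/-- The initial velocity `γ'_0` of `γ`. -/
noncomputable def ofGeo (γ : Geo y) : TangentCone y := UniformSpace.Completion.coe' γ

theorem dist_ofGeo (γ η : Geo y) : dist (ofGeo γ) (ofGeo η) = dist γ η :=
  UniformSpace.Completion.dist_eq γ η

noncomputable instance : Zero (TangentCone y) where
  zero := ofGeo 0

/-- Multiplication by `c ≥ 0`, extended by continuity from `Geo y`. -/
noncomputable instance : SMul ℝ≥0 (TangentCone y) where
  smul c := UniformSpace.Completion.map (fun γ : Geo y => c • γ)

theorem smul_ofGeo (c : ℝ≥0) (γ : Geo y) : c • ofGeo γ = ofGeo (c • γ) :=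
  UniformSpace.Completion.map_coe (Geo.lipschitzWith_smul c).uniformContinuous γ

/-- The norm `|v|_y = d_y(v, 0)`. -/
noncomputable def norm (v : TangentCone y) : ℝ := dist v 0

/-- The scalar product `⟨v, w⟩_y = (|v|² + |w|² - d_y(v,w)²) / 2`. -/
noncomputable def inner (v w : TangentCone y) : ℝ :=
  (norm v ^ 2 + norm w ^ 2 - dist v w ^ 2) / 2

end TangentCone

/-- The geodesic from `y` to `z` in a CAT(0) space, as an element of `Geo y`
(the geodesic on `[0,1]` is unique, so the choice is immaterial). -/
noncomputable def geoTo {Y : Type*} [MetricSpace Y] [CAT0Space Y] (y z : Y) : Geo y where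
  toFun := (CAT0Space.exists_geodesic y z).choose
  map_zero := (CAT0Space.exists_geodesic y z).choose_spec.2.1
  isGeodesic := ⟨1, one_pos, _, dist_nonneg, (CAT0Space.exists_geodesic y z).choose_spec.1⟩

/-- The vector `(G_y^z)'_0 ∈ T_y Y`. -/
noncomputable def dirTo {Y : Type*} [MetricSpace Y] [CAT0Space Y] (y z : Y) : TangentCone y :=
  TangentCone.ofGeo (geoTo y z)

/-! ### The geometric tangent bundle and its pullback -/

/-- The geometric tangent bundle `T_G Y = {(y, v) : y ∈ Y, v ∈ T_y Y}`. -/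
structure TangentBdl (Y : Type*) [MetricSpace Y] where
  base : Y
  vec : TangentCone base

/-- The σ-algebra `𝓑(T_G Y)`: the smallest one for which the projection to `Y` and all the maps
`(y, v) ↦ ⟨v, (G_y^z)'_0⟩_y`, `z ∈ Y`, are measurable. (In a CAT(0) space all balls are CAT(0), so
these maps are defined on the whole of `T_G Y`.) -/
noncomputable instance TangentBdl.measurableSpace (Y : Type*) [MetricSpace Y] [CAT0Space Y]
    [MeasurableSpace Y] : MeasurableSpace (TangentBdl Y) :=
  MeasurableSpace.comap TangentBdl.base inferInstance ⊔
    ⨆ z : Y, MeasurableSpace.comap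
      (fun p : TangentBdl Y => TangentCone.inner p.vec (dirTo p.base z)) (borel ℝ)

/-- The pullback bundle `u^* T_G Y = {(x, y, v) : y = u(x), v ∈ T_y Y}`. As a subtype of
`α × TangentBdl Y`, it carries the restriction of the product σ-algebra. -/
def PullbackBdl {α Y : Type*} [MetricSpace Y] (u : α → Y) : Type _ :=
  {p : α × TangentBdl Y // p.2.base = u p.1}

noncomputable instance PullbackBdl.measurableSpace {α Y : Type*} [MeasurableSpace α] [MetricSpace Y]
    [CAT0Space Y] [MeasurableSpace Y] (u : α → Y) : MeasurableSpace (PullbackBdl u) :=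
  inferInstanceAs (MeasurableSpace {p : α × TangentBdl Y // p.2.base = u p.1})

/-- A section of `u^* T_G Y`, given by its vector part `x ↦ S_x ∈ T_{u(x)} Y`. -/
abbrev BdlSection {α Y : Type*} [MetricSpace Y] (u : α → Y) : Type _ :=
  ∀ x : α, TangentCone (u x)

/-- The map `x ↦ (x, u(x), S_x)` into `u^* T_G Y`. -/
def BdlSection.graph {α Y : Type*} [MetricSpace Y] {u : α → Y} (S : BdlSection u) (x : α) :
    PullbackBdl u :=
  ⟨(x, ⟨u x, S x⟩), rfl⟩

/-- A section is Borel if `x ↦ (x, u(x), S_x)` is measurable. -/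
def IsBorelSection {α Y : Type*} [MeasurableSpace α] [MetricSpace Y] [CAT0Space Y]
    [MeasurableSpace Y] {u : α → Y} (S : BdlSection u) : Prop :=
  Measurable S.graph

/-! ### The space `L²(u^* T_G Y)` -/

/-- `v` is essentially separably valued: it takes a.e. values in some separable set. -/
def EssSepValued {α Y : Type*} [MeasurableSpace α] [MetricSpace Y] (μ : Measure α)
    (v : α → Y) : Prop :=
  ∃ s : Set Y, TopologicalSpace.IsSeparable s ∧ μ (v ⁻¹' sᶜ) = 0

/-- `d_{L²}(S, T) = (∫ d_{u(x)}(S_x, T_x)² dμ(x))^{1/2} ∈ [0, ∞]`. -/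
noncomputable def distL2 {α Y : Type*} [MeasurableSpace α] [MetricSpace Y] (μ : Measure α)
    {u : α → Y} (S T : BdlSection u) : ℝ≥0∞ :=
  (∫⁻ x, ENNReal.ofReal (dist (S x) (T x) ^ 2) ∂μ) ^ (1 / 2 : ℝ)

/-- The section `x ↦ c (G_{u(x)}^{v(x)})'_0`. -/
noncomputable def dirSection {α Y : Type*} [MetricSpace Y] [CAT0Space Y] (u : α → Y)
    (c : ℝ≥0) (v : α → Y) : BdlSection u :=
  fun x => c • dirTo (u x) (v x)

/-- The sections of class `𝓛²(u^* T_G Y, μ)`. -/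
structure MemCalL2 {α Y : Type*} [MeasurableSpace α] [MetricSpace Y] [CAT0Space Y]
    [MeasurableSpace Y] (μ : Measure α) (u : α → Y) (S : BdlSection u) : Prop where
  measurable_dist : ∀ (c : ℝ≥0) (v : α → Y), Measurable v → EssSepValued μ v →
    Measurable fun x => dist (S x) (dirSection u c v x)
  exists_seq : ∃ (c : ℕ → ℝ≥0) (v : ℕ → α → Y),
    (∀ n, Measurable (v n) ∧ EssSepValued μ (v n)) ∧
    (⨆ n, distL2 μ (dirSection u (c n) (v n)) (fun _ => 0)) < ∞ ∧
    ∀ x, Tendsto (fun n => dist (dirSection u (c n) (v n) x) (S x)) atTop (𝓝 0)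

section L2

variable {α Y : Type*} [MeasurableSpace α] [MetricSpace Y] [CAT0Space Y] [MeasurableSpace Y]

theorem MemCalL2.measurable_dist_memCalL2 {μ : Measure α} {u : α → Y} {S T : BdlSection u}
    (hS : MemCalL2 μ u S) (hT : MemCalL2 μ u T) : Measurable fun x => dist (S x) (T x) := by
  obtain ⟨c, v, hv, -, hlim⟩ := hT.exists_seq
  refine measurable_of_tendsto_metrizable
    (fun n => hS.measurable_dist (c n) (v n) (hv n).1 (hv n).2) ?_
  rw [tendsto_pi_nhds]
  intro x
  exact (tendsto_const_nhds (x := S x)).dist (tendsto_iff_dist_tendsto_zero.2 (hlim x))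

/-- Within `𝓛²`, vanishing of `d_{L²}` is a.e. equality. -/
theorem MemCalL2.distL2_eq_zero_iff {μ : Measure α} {u : α → Y} {S T : BdlSection u}
    (hS : MemCalL2 μ u S) (hT : MemCalL2 μ u T) :
    distL2 μ S T = 0 ↔ ∀ᵐ x ∂μ, S x = T x := by
  have hm : Measurable fun x => ENNReal.ofReal (dist (S x) (T x) ^ 2) :=
    ((hS.measurable_dist_memCalL2 hT).pow_const 2).ennreal_ofReal
  have h0 : distL2 μ S T = 0 ↔ ∫⁻ x, ENNReal.ofReal (dist (S x) (T x) ^ 2) ∂μ = 0 := by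
    unfold distL2
    constructor
    · intro h
      rcases ENNReal.rpow_eq_zero_iff.1 h with h | h
      · exact h.1
      · norm_num at h
    · intro h
      rw [h, ENNReal.zero_rpow_of_pos (by norm_num)]
  rw [h0, lintegral_eq_zero_iff hm]
  refine eventually_congr (Eventually.of_forall fun x => ?_)
  have h1 : 0 ≤ dist (S x) (T x) := dist_nonneg
  simp only [Pi.zero_apply, ENNReal.ofReal_eq_zero]
  constructor
  · intro h
    exact dist_eq_zero.1 (pow_eq_zero_iff two_ne_zero |>.1 (le_antisymm h (sq_nonneg _)))
  · intro h
    simp [h]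

/-- The relation `d_{L²}(S, T) = 0` on `𝓛²(u^* T_G Y, μ)`. -/
def calL2Setoid (μ : Measure α) (u : α → Y) : Setoid {S : BdlSection u // MemCalL2 μ u S} where
  r S T := distL2 μ S.1 T.1 = 0
  iseqv :=
    { refl := fun S => (S.2.distL2_eq_zero_iff S.2).2 (Eventually.of_forall fun _ => rfl)
      symm := fun {S T} h => (T.2.distL2_eq_zero_iff S.2).2
        (((S.2.distL2_eq_zero_iff T.2).1 h).mono fun _ hx => hx.symm)
      trans := fun {S T R} h h' => (S.2.distL2_eq_zero_iff R.2).2 (by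
        filter_upwards [(S.2.distL2_eq_zero_iff T.2).1 h, (T.2.distL2_eq_zero_iff R.2).1 h']
          with x h1 h2
        exact h1.trans h2) }

/-- `L²(u^* T_G Y, μ)`: the quotient of `𝓛²(u^* T_G Y, μ)` by `d_{L²} = 0`. -/
def L2 (μ : Measure α) (u : α → Y) : Type _ := Quotient (calL2Setoid μ u)

/-- Equivalence classes of arbitrary sections of `u^* T_G Y` up to `μ`-a.e. equality. -/
abbrev AESection {α Y : Type*} [MeasurableSpace α] [MetricSpace Y] (μ : Measure α)
    (u : α → Y) : Type _ :=
  (ae μ).Product fun x => TangentCone (u x)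

/-- The class of a section up to `μ`-a.e. equality. -/
def AESection.mk {α Y : Type*} [MeasurableSpace α] [MetricSpace Y] (μ : Measure α)
    {u : α → Y} (S : BdlSection u) : AESection μ u :=
  (S : (ae μ).Product fun x => TangentCone (u x))

theorem AESection.mk_eq_mk {α Y : Type*} [MeasurableSpace α] [MetricSpace Y] (μ : Measure α)
    {u : α → Y} (S T : BdlSection u) :
    AESection.mk μ S = AESection.mk μ T ↔ ∀ᵐ x ∂μ, S x = T x :=
  Quotient.eq''

/-- The canonical map sending the class in `L²(u^* T_G Y, μ)` of a section `S` to its class up to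
`μ`-a.e. equality. -/
def L2.toAE (μ : Measure α) (u : α → Y) : L2 μ u → AESection μ u :=
  Quotient.lift (fun S => AESection.mk μ S.1) fun S T h =>
    (AESection.mk_eq_mk μ S.1 T.1).2 ((S.2.distL2_eq_zero_iff T.2).1 h)

end L2

end GeomTangent

/-! On $\mathcal L^2$ the function $x\mapsto d(S_x,T_x)$ is measurable, so $d_{L^2}(S,T)=0$ means
a.e. equality; hence the map is well defined and injective. The rest is `memCalL2_iff`: $\mathcal
L^2$ is, without passing to classes, the set of Borel sections with square integrable norm.

The geometric input is $d(v,w)^2=|v|^2+|w|^2-2\langle v,w\rangle$ together with $\langle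
v,cw\rangle=c\langle v,w\rangle$ for $w$ the velocity of a geodesic (`inner_smul_ofGeo`). This
homogeneity is where CAT(0) enters: comparison angles are monotone, so the limsup defining $d_y$ is
a limit, and the same scalar product appears at every ratio of speeds. Moreover, the vectors
$n(G_y^{z_i})'_0$, with $(z_i)$ dense in $Y$, are dense in $T_yY$.

If $S\in\mathcal L^2$, distances to constant-target directions determine the scalar products, so $S$
is Borel; Fatou bounds the norm. Conversely, the norm of a Borel section is a countable supremum of
measurable functions, whence its distances to test sections are measurable; a measurable choice
among the dense vectors gives the approximating sequence. -/

namespace GeomTangent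

/-! ### CAT(0) comparison inequalities -/

section Comparison

variable {Y : Type*} [MetricSpace Y] [CAT0Space Y]

/-- The Bruhat–Tits (CN) inequality for an arbitrary point of a geodesic. -/
theorem dist_sq_le_of_between {a b c d : Y} {t : ℝ} (ht : t ∈ Icc (0 : ℝ) 1)
    (hb : dist b d = t * dist b c) (hc : dist d c = (1 - t) * dist b c) :
    dist a d ^ 2 ≤ (1 - t) * dist a b ^ 2 + t * dist a c ^ 2 - t * (1 - t) * dist b c ^ 2 := by
  rcases eq_or_ne b c with rfl | hne
  · have h : dist b d = 0 := by simpa using hb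
    rw [dist_eq_zero] at h
    subst h
    simp only [dist_self]
    nlinarith
  have hL : 0 < dist b c := dist_pos.2 hne
  have h1 := dist_triangle a b c
  have h2 := dist_triangle_left b c a
  have h3 := dist_triangle_right a b c
  have hx : 0 ≤ dist a b := dist_nonneg
  have hy : 0 ≤ dist a c := dist_nonneg
  set x := dist a b with hxdef
  set y := dist a c with hydef
  set l := dist b c with hldef
  -- The comparison triangle has $b'=(0,0)$, $c'=(l,0)$, $a'=(p,q)$; the law of cosines gives $p$.
  set p : ℝ := (x ^ 2 + l ^ 2 - y ^ 2) / (2 * l) with hp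
  have hpl : 2 * l * p = x ^ 2 + l ^ 2 - y ^ 2 := by rw [hp]; field_simp
  -- Heron's factorization: each factor is nonnegative by a triangle inequality.
  have hq : 0 ≤ x ^ 2 - p ^ 2 := by
    have e : (2 * l) ^ 2 * (x ^ 2 - p ^ 2)
        = ((x + l - y) * (x + l + y)) * ((y + x - l) * (y + l - x)) := by
      linear_combination (-(2 * l * p) - (x ^ 2 + l ^ 2 - y ^ 2)) * hpl
    have : 0 ≤ (2 * l) ^ 2 * (x ^ 2 - p ^ 2) := by
      rw [e]
      exact mul_nonneg (mul_nonneg (by linarith) (by linarith))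
        (mul_nonneg (by linarith) (by linarith))
    exact nonneg_of_mul_nonneg_right this (by positivity)
  set q := Real.sqrt (x ^ 2 - p ^ 2) with hqdef
  have hq2 : q ^ 2 = x ^ 2 - p ^ 2 := Real.sq_sqrt hq
  have key := CAT0Space.comparison a b c d !₂[p, q] !₂[0, 0] !₂[l, 0] !₂[t * l, 0]
    (by rw [hb, hc]; ring)
    (by
      rw [EuclideanSpace.dist_eq, ← hxdef, Real.sqrt_eq_iff_eq_sq (by positivity) hx]
      simp [Fin.sum_univ_two, Real.dist_eq, hq2])
    (by
      rw [EuclideanSpace.dist_eq, ← hldef, Real.sqrt_eq_iff_eq_sq (by positivity) hL.le]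
      simp [Fin.sum_univ_two, Real.dist_eq])
    (by
      rw [EuclideanSpace.dist_eq, dist_comm c a, ← hydef,
        Real.sqrt_eq_iff_eq_sq (by positivity) hy]
      simp only [Fin.sum_univ_two, Real.dist_eq, sq_abs]
      simp
      linear_combination hq2 - hpl)
    (by
      rw [EuclideanSpace.dist_eq, dist_comm d b, hb,
        Real.sqrt_eq_iff_eq_sq (by positivity) (mul_nonneg ht.1 hL.le)]
      simp [Fin.sum_univ_two, Real.dist_eq])
    (by
      rw [EuclideanSpace.dist_eq, hc,
        Real.sqrt_eq_iff_eq_sq (by positivity) (mul_nonneg (by linarith [ht.2]) hL.le)]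
      simp only [Fin.sum_univ_two, Real.dist_eq, sq_abs]
      simp
      ring)
  have hsq := pow_le_pow_left₀ dist_nonneg key 2
  refine hsq.trans (le_of_eq ?_)
  rw [EuclideanSpace.dist_eq, Real.sq_sqrt (by positivity)]
  simp only [Fin.sum_univ_two, Real.dist_eq, sq_abs]
  simp
  linear_combination hq2 - t * hpl

/-- Comparison for two points on two sides of a triangle. -/
theorem dist_sq_le_of_between_of_between {y z z' p q : Y} {s t : ℝ}
    (hs : s ∈ Icc (0 : ℝ) 1) (ht : t ∈ Icc (0 : ℝ) 1)
    (hp : dist y p = s * dist y z) (hp' : dist p z = (1 - s) * dist y z)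
    (hq : dist y q = t * dist y z') (hq' : dist q z' = (1 - t) * dist y z') :
    dist p q ^ 2 ≤ s * (s - t) * dist y z ^ 2 + t * (t - s) * dist y z' ^ 2
      + s * t * dist z z' ^ 2 := by
  -- Compare $p$ with the side $yz'$; the distance from $p$ to $z'$ that appears is then bounded by
  -- comparing $z'$ with the side $yz$.
  have h1 := dist_sq_le_of_between (a := p) ht hq hq'
  have h2 := dist_sq_le_of_between (a := z') hs hp hp'
  rw [dist_comm p y, hp, dist_comm p z'] at h1
  rw [dist_comm z' y, dist_comm z' z] at h2
  nlinarith [mul_le_mul_of_nonneg_left h2 ht.1]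

theorem IsGeodesic.dist_zero_left {Y : Type*} [MetricSpace Y] {γ : ℝ → Y} (h : IsGeodesic γ)
    {t : ℝ} (ht : t ∈ Icc (0 : ℝ) 1) : dist (γ 0) (γ t) = t * dist (γ 0) (γ 1) := by
  rw [dist_comm, h 0 (by simp) t ht, sub_zero, abs_of_nonneg ht.1]

theorem IsGeodesic.dist_one_right {Y : Type*} [MetricSpace Y] {γ : ℝ → Y} (h : IsGeodesic γ)
    {t : ℝ} (ht : t ∈ Icc (0 : ℝ) 1) : dist (γ t) (γ 1) = (1 - t) * dist (γ 0) (γ 1) := by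
  rw [dist_comm, h t ht 1 (by simp), abs_of_nonneg (by linarith [ht.2])]

/-- Geodesics with a common starting point spread at least linearly. -/
theorem IsGeodesic.dist_le {γ η : ℝ → Y} (hγ : IsGeodesic γ) (hη : IsGeodesic η)
    (h0 : γ 0 = η 0) {t : ℝ} (ht : t ∈ Icc (0 : ℝ) 1) :
    dist (γ t) (η t) ≤ t * dist (γ 1) (η 1) := by
  have h := dist_sq_le_of_between_of_between ht ht (hγ.dist_zero_left ht) (hγ.dist_one_right ht)
    (h0 ▸ hη.dist_zero_left ht) (h0 ▸ hη.dist_one_right ht)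
  refine le_of_sq_le_sq ?_ (mul_nonneg ht.1 dist_nonneg)
  linarith

theorem geoTo_isGeodesic (y z : Y) : IsGeodesic (geoTo y z).toFun :=
  (CAT0Space.exists_geodesic y z).choose_spec.1

theorem geoTo_zero (y z : Y) : (geoTo y z).toFun 0 = y := (geoTo y z).map_zero

theorem geoTo_one (y z : Y) : (geoTo y z).toFun 1 = z :=
  (CAT0Space.exists_geodesic y z).choose_spec.2.2

/-- Uniqueness of geodesics: two of them with equal starting points are at time $t$ at most $t$
times as far apart as their endpoints, which here coincide. -/
theorem IsGeodesic.eq_geoTo {γ : ℝ → Y} (hγ : IsGeodesic γ) {t : ℝ} (ht : t ∈ Icc (0 : ℝ) 1) :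
    γ t = (geoTo (γ 0) (γ 1)).toFun t := by
  have h := hγ.dist_le (geoTo_isGeodesic (γ 0) (γ 1)) (geoTo_zero _ _).symm ht
  rw [geoTo_one, dist_self, mul_zero] at h
  exact dist_le_zero.1 h

end Comparison

/-! ### Comparison angles and the first-order limit -/

namespace Geo

section

variable {Y : Type*} [MetricSpace Y] {y : Y}

/-- `γ` has constant speed `k` on `[0, ε]`. -/
def HasSpeedOn (γ : Geo y) (ε k : ℝ) : Prop :=
  ∀ s ∈ Icc (0 : ℝ) ε, ∀ t ∈ Icc (0 : ℝ) ε, dist (γ.toFun t) (γ.toFun s) = |t - s| * k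

theorem HasSpeedOn.mono {γ : Geo y} {ε δ k : ℝ} (h : γ.HasSpeedOn ε k) (hδ : δ ≤ ε) :
    γ.HasSpeedOn δ k := fun s hs t ht => h s ⟨hs.1, hs.2.trans hδ⟩ t ⟨ht.1, ht.2.trans hδ⟩

theorem HasSpeedOn.dist_base {γ : Geo y} {ε k t : ℝ} (h : γ.HasSpeedOn ε k)
    (ht : t ∈ Icc (0 : ℝ) ε) : dist y (γ.toFun t) = t * k := by
  have := h 0 ⟨le_rfl, ht.1.trans ht.2⟩ t ht
  rwa [γ.map_zero, sub_zero, abs_of_nonneg ht.1, dist_comm] at this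

theorem dist_eq_of_tendsto {γ η : Geo y} {a : ℝ} (h : Tendsto (quot γ η) (𝓝[>] 0) (𝓝 a)) :
    dist γ η = a := h.limsup_eq

theorem HasSpeedOn.dist_zero {γ : Geo y} {ε k : ℝ} (hε : 0 < ε) (h : γ.HasSpeedOn ε k) :
    dist γ 0 = k := by
  refine dist_eq_of_tendsto (tendsto_const_nhds.congr' ?_)
  filter_upwards [Ioo_mem_nhdsGT hε] with t ht
  have h1 : dist (γ.toFun t) ((0 : Geo y).toFun t) = t * k := by
    rw [dist_comm]; exact h.dist_base ⟨ht.1.le, ht.2.le⟩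
  rw [quot, h1, mul_div_cancel_left₀ _ ht.1.ne']

theorem zero_smul' (γ : Geo y) : dist ((0 : ℝ≥0) • γ) 0 = 0 := by
  refine dist_eq_of_tendsto (tendsto_const_nhds.congr fun t => ?_)
  have : ((0 : ℝ≥0) • γ).toFun t = y := by simp [smul_toFun, γ.map_zero]
  have h0 : (0 : Geo y).toFun t = y := rfl
  simp [quot, this, h0]

theorem one_smul' (γ : Geo y) : dist ((1 : ℝ≥0) • γ) γ = 0 := by
  refine dist_eq_of_tendsto (tendsto_const_nhds.congr fun t => ?_)
  simp [quot, smul_toFun]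

theorem dist_smul_zero (c : ℝ≥0) (γ : Geo y) : dist (c • γ) 0 = c * dist γ 0 := by
  obtain ⟨ε, hε, k, -, h⟩ := γ.isGeodesic
  rw [HasSpeedOn.dist_zero hε h]
  -- Dividing by $c+1$ rather than $c$ also covers $c=0$.
  have hc : (0 : ℝ) < c + 1 := by positivity
  refine HasSpeedOn.dist_zero (div_pos hε hc) (fun s hs t ht => ?_)
  have key : ∀ s ∈ Icc (0 : ℝ) (ε / (c + 1)), (c : ℝ) * s ∈ Icc (0 : ℝ) ε := by
    intro s hs
    refine ⟨mul_nonneg c.2 hs.1, ?_⟩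
    have := (le_div_iff₀ hc).1 hs.2
    nlinarith [hs.1]
  rw [smul_toFun, smul_toFun, h _ (key s hs) _ (key t ht), ← mul_sub, abs_mul, NNReal.abs_eq]
  ring

/-- The comparison scalar product of `γ'_0` and `η'_0` at the scales `s` and `t`. -/
noncomputable def compInner (γ η : Geo y) (A B s t : ℝ) : ℝ :=
  (s ^ 2 * A ^ 2 + t ^ 2 * B ^ 2 - dist (γ.toFun s) (η.toFun t) ^ 2) / (2 * s * t)

/-- The reverse triangle inequality $|sA-tB|\le d(\gamma_s,\eta_t)$, squared. -/
theorem compInner_le {γ η : Geo y} {ε A B : ℝ} (hγ : γ.HasSpeedOn ε A) (hη : η.HasSpeedOn ε B)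
    {s t : ℝ} (hs : 0 < s) (ht : 0 < t) (hs' : s ≤ ε) (ht' : t ≤ ε) :
    compInner γ η A B s t ≤ A * B := by
  have e1 : dist y (γ.toFun s) = s * A := hγ.dist_base ⟨hs.le, hs'⟩
  have e2 : dist y (η.toFun t) = t * B := hη.dist_base ⟨ht.le, ht'⟩
  have h := abs_dist_sub_le (γ.toFun s) (η.toFun t) y
  rw [dist_comm _ y, dist_comm _ y, e1, e2] at h
  have h2 := pow_le_pow_left₀ (abs_nonneg _) h 2
  rw [sq_abs] at h2
  unfold compInner
  rw [div_le_iff₀ (by positivity)]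
  nlinarith

end

variable {Y : Type*} [MetricSpace Y] [CAT0Space Y] {y : Y}

/-- Monotonicity of comparison angles, a rearrangement of the two-sided comparison for points on the
sides of the larger triangle. -/
theorem compInner_anti {γ η : Geo y} {ε A B : ℝ} (hγ : γ.HasSpeedOn ε A) (hη : η.HasSpeedOn ε B)
    {s t s' t' : ℝ} (hs : 0 < s) (ht : 0 < t) (hss : s ≤ s') (htt : t ≤ t') (hs' : s' ≤ ε)
    (ht' : t' ≤ ε) : compInner γ η A B s' t' ≤ compInner γ η A B s t := by
  have hs0 : 0 < s' := hs.trans_le hss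
  have ht0 : 0 < t' := ht.trans_le htt
  have e1 : dist y (γ.toFun s') = s' * A := hγ.dist_base ⟨hs0.le, hs'⟩
  have e2 : dist y (η.toFun t') = t' * B := hη.dist_base ⟨ht0.le, ht'⟩
  have e3 : dist (γ.toFun s) (γ.toFun s') = (s' - s) * A := by
    rw [dist_comm, hγ s ⟨hs.le, hss.trans hs'⟩ s' ⟨hs0.le, hs'⟩, abs_of_nonneg (by linarith)]
  have e4 : dist (η.toFun t) (η.toFun t') = (t' - t) * B := by
    rw [dist_comm, hη t ⟨ht.le, htt.trans ht'⟩ t' ⟨ht0.le, ht'⟩, abs_of_nonneg (by linarith)]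
  have h := dist_sq_le_of_between_of_between (y := y) (z := γ.toFun s') (z' := η.toFun t')
    (p := γ.toFun s) (q := η.toFun t) (s := s / s') (t := t / t')
    ⟨by positivity, (div_le_one hs0).2 hss⟩ ⟨by positivity, (div_le_one ht0).2 htt⟩
    (by rw [hγ.dist_base ⟨hs.le, hss.trans hs'⟩, e1]; field_simp)
    (by rw [e3, e1]; field_simp)
    (by rw [hη.dist_base ⟨ht.le, htt.trans ht'⟩, e2]; field_simp)
    (by rw [e4, e2]; field_simp)
  rw [e1, e2] at h
  set D := dist (γ.toFun s') (η.toFun t')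
  set d := dist (γ.toFun s) (η.toFun t)
  have h' : d ^ 2 ≤ s ^ 2 * A ^ 2 + t ^ 2 * B ^ 2
      - 2 * s * t * ((s' ^ 2 * A ^ 2 + t' ^ 2 * B ^ 2 - D ^ 2) / (2 * s' * t')) := by
    refine h.trans (le_of_eq ?_)
    field_simp
    ring
  unfold compInner
  rw [le_div_iff₀ (by positivity)]
  linarith

/-- On the diagonal $s=t$ the quantity is monotone and bounded, hence converges. For ratio $c$ it is
squeezed between its diagonal values at $\max(1,c)t$ and $\min(1,c)t$, so the limit does not depend
on $c$. -/
theorem exists_tendsto_compInner {γ η : Geo y} {ε A B : ℝ} (hε : 0 < ε) (hγ : γ.HasSpeedOn ε A)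
    (hη : η.HasSpeedOn ε B) : ∃ I : ℝ, ∀ c : ℝ, 0 < c →
      Tendsto (fun t => compInner γ η A B t (c * t)) (𝓝[>] 0) (𝓝 I) := by
  have hanti : AntitoneOn (fun t => compInner γ η A B t t) (Ioo 0 ε) := fun s hs t ht hst =>
    compInner_anti hγ hη hs.1 hs.1 hst hst ht.2.le ht.2.le
  have hbdd : BddAbove ((fun t => compInner γ η A B t t) '' Ioo 0 ε) := by
    refine ⟨A * B, ?_⟩
    rintro _ ⟨t, ht, rfl⟩
    exact compInner_le hγ hη ht.1 ht.1 ht.2.le ht.2.le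
  have hlim := hanti.tendsto_nhdsWithin_Ioo_right (nonempty_Ioo.2 hε) hbdd
  have hmul : ∀ m : ℝ, 0 < m → Tendsto (fun t : ℝ => m * t) (𝓝[>] 0) (𝓝[>] 0) := by
    intro m hm
    refine tendsto_nhdsWithin_iff.2 ⟨?_, ?_⟩
    · have : Tendsto (fun t : ℝ => m * t) (𝓝 0) (𝓝 (m * 0)) :=
        (continuous_const.mul continuous_id).tendsto 0
      rw [mul_zero] at this
      exact this.mono_left nhdsWithin_le_nhds
    · filter_upwards [self_mem_nhdsWithin] with t ht
      exact mul_pos hm ht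
  refine ⟨sSup ((fun t => compInner γ η A B t t) '' Ioo 0 ε), fun c hc => ?_⟩
  have hM : 0 < max 1 c := by positivity
  have hm : 0 < min 1 c := by positivity
  have hsmall := (hmul _ hM).eventually (Ioo_mem_nhdsGT hε)
  refine tendsto_of_tendsto_of_tendsto_of_le_of_le' (hlim.comp (hmul _ hM))
    (hlim.comp (hmul _ hm)) ?_ ?_
  · filter_upwards [hsmall, self_mem_nhdsWithin] with t h ht
    have ht : 0 < t := ht
    refine compInner_anti hγ hη ht (by positivity) ?_ ?_ h.2.le h.2.le
    · nlinarith [le_max_left 1 c]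
    · nlinarith [le_max_right 1 c]
  · filter_upwards [hsmall, self_mem_nhdsWithin] with t h ht
    have ht : 0 < t := ht
    refine compInner_anti hγ hη (by positivity) (by positivity) ?_ ?_ ?_ ?_
    · nlinarith [min_le_left 1 c]
    · nlinarith [min_le_right 1 c]
    · nlinarith [le_max_left 1 c, h.2]
    · nlinarith [le_max_right 1 c, h.2]

theorem exists_dist_smul_sq (γ η : Geo y) : ∃ I : ℝ, ∀ c : ℝ≥0,
    dist γ (c • η) ^ 2 = dist γ 0 ^ 2 + c ^ 2 * dist η 0 ^ 2 - 2 * c * I := by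
  obtain ⟨ε, hε, A, -, hγ⟩ := γ.isGeodesic
  obtain ⟨δ, hδ, B, -, hη⟩ := η.isGeodesic
  have hγ0 : dist γ 0 = A := HasSpeedOn.dist_zero hε hγ
  have hη0 : dist η 0 = B := HasSpeedOn.dist_zero hδ hη
  have hγ' : γ.HasSpeedOn (min ε δ) A := HasSpeedOn.mono hγ (min_le_left _ _)
  have hη' : η.HasSpeedOn (min ε δ) B := HasSpeedOn.mono hη (min_le_right _ _)
  obtain ⟨I, hI⟩ := exists_tendsto_compInner (lt_min hε hδ) hγ' hη'
  refine ⟨I, fun c => ?_⟩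
  -- At $c=0$ `compInner` would divide by zero.
  rcases eq_or_lt_of_le (zero_le (a := c)) with rfl | hc
  · have h1 : dist γ ((0 : ℝ≥0) • η) = dist γ 0 := by
      have := abs_dist_sub_le ((0 : ℝ≥0) • η) 0 γ
      rw [zero_smul', abs_nonpos_iff, sub_eq_zero] at this
      rw [dist_comm, this, dist_comm]
    rw [h1]; simp
  have hc' : (0 : ℝ) < c := hc
  have hsq : Tendsto (fun t => quot γ (c • η) t ^ 2) (𝓝[>] 0)
      (𝓝 (A ^ 2 + c ^ 2 * B ^ 2 - 2 * c * I)) := by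
    refine (((hI c hc').const_mul (2 * (c : ℝ))).const_sub
      (A ^ 2 + c ^ 2 * B ^ 2)).congr' ?_
    filter_upwards [self_mem_nhdsWithin] with t ht
    have ht : 0 < t := ht
    simp only [compInner, quot, smul_toFun]
    field_simp
    ring
  have hq : Tendsto (quot γ (c • η)) (𝓝[>] 0)
      (𝓝 (Real.sqrt (A ^ 2 + c ^ 2 * B ^ 2 - 2 * c * I))) := by
    refine ((Real.continuous_sqrt.tendsto _).comp hsq).congr' ?_
    filter_upwards [quot_nonneg γ (c • η)] with t ht
    exact Real.sqrt_sq ht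
  rw [dist_eq_of_tendsto hq, hγ0, hη0, Real.sq_sqrt]
  exact ge_of_tendsto' hsq fun t => sq_nonneg _

end Geo

/-! ### Scalar product on the tangent cone -/

namespace TangentCone

section

variable {Y : Type*} [MetricSpace Y] {y : Y}

theorem norm_nonneg (v : TangentCone y) : 0 ≤ norm v := dist_nonneg

theorem ofGeo_eq_ofGeo {γ η : Geo y} (h : dist γ η = 0) : ofGeo γ = ofGeo η :=
  dist_eq_zero.1 (by rw [dist_ofGeo, h])

theorem denseRange_ofGeo : DenseRange (ofGeo : Geo y → TangentCone y) :=
  UniformSpace.Completion.denseRange_coe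

theorem zero_smul_ofGeo (γ : Geo y) : (0 : ℝ≥0) • ofGeo γ = 0 := by
  rw [smul_ofGeo]; exact ofGeo_eq_ofGeo (Geo.zero_smul' γ)

theorem one_smul_ofGeo (γ : Geo y) : (1 : ℝ≥0) • ofGeo γ = ofGeo γ := by
  rw [smul_ofGeo]; exact ofGeo_eq_ofGeo (Geo.one_smul' γ)

theorem norm_ofGeo (γ : Geo y) : norm (ofGeo γ) = dist γ 0 := dist_ofGeo γ 0

theorem norm_smul_ofGeo (c : ℝ≥0) (γ : Geo y) : norm (c • ofGeo γ) = c * norm (ofGeo γ) := by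
  rw [smul_ofGeo, norm_ofGeo, norm_ofGeo, Geo.dist_smul_zero]

theorem dist_smul_ofGeo_le (c : ℝ≥0) (γ η : Geo y) :
    dist (c • ofGeo γ) (c • ofGeo η) ≤ c * dist (ofGeo γ) (ofGeo η) := by
  rw [smul_ofGeo, smul_ofGeo, dist_ofGeo, dist_ofGeo]
  exact (Geo.lipschitzWith_smul c).dist_le_mul γ η

theorem continuous_norm : Continuous (norm : TangentCone y → ℝ) :=
  continuous_id.dist continuous_const

theorem continuous_inner : Continuous fun p : TangentCone y × TangentCone y => inner p.1 p.2 := by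
  unfold inner
  have := continuous_norm (y := y)
  fun_prop

theorem inner_le_norm_mul_norm (v w : TangentCone y) : inner v w ≤ norm v * norm w := by
  have h := abs_dist_sub_le v w 0
  have h2 := pow_le_pow_left₀ (abs_nonneg _) h 2
  rw [sq_abs] at h2
  unfold inner norm
  nlinarith

theorem dist_sq (v w : TangentCone y) :
    dist v w ^ 2 = norm v ^ 2 + norm w ^ 2 - 2 * inner v w := by
  unfold inner; ring

end

variable {Y : Type*} [MetricSpace Y] [CAT0Space Y] {y : Y}

/-- Both sides are continuous in $v$, so $v$ may be taken to be a velocity; there the common limit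
$I$ works for all $c$, and $c=1$ identifies it. -/
theorem inner_smul_ofGeo (v : TangentCone y) (c : ℝ≥0) (η : Geo y) :
    inner v (c • ofGeo η) = c * inner v (ofGeo η) := by
  have hcont : ∀ w : TangentCone y, Continuous fun v : TangentCone y => inner v w := fun w =>
    continuous_inner.comp (continuous_id.prodMk continuous_const)
  refine congrFun (denseRange_ofGeo.equalizer (hcont _) (continuous_const.mul (hcont _))
    (funext fun γ => ?_)) v
  obtain ⟨I, hI⟩ := Geo.exists_dist_smul_sq γ η
  have h : ∀ c : ℝ≥0, inner (ofGeo γ) (c • ofGeo η) = c * I := by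
    intro c
    have h2 : dist (ofGeo γ) (c • ofGeo η) ^ 2 = norm (ofGeo γ) ^ 2 +
        (c * norm (ofGeo η)) ^ 2 - 2 * c * I := by
      rw [smul_ofGeo, dist_ofGeo, hI, norm_ofGeo, norm_ofGeo]
      ring
    rw [inner, norm_smul_ofGeo, h2]
    ring
  have h1 := h 1
  rw [one_smul_ofGeo, NNReal.coe_one, one_mul] at h1
  change inner (ofGeo γ) (c • ofGeo η) = c * inner (ofGeo γ) (ofGeo η)
  rw [h c, h1]

end TangentCone

/-! ### Density of multiples of directions to points -/

section DirTo

open TangentCone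

variable {Y : Type*} [MetricSpace Y] [CAT0Space Y]

theorem norm_dirTo (y z : Y) : norm (dirTo y z) = dist y z := by
  rw [dirTo, norm_ofGeo]
  refine Geo.HasSpeedOn.dist_zero one_pos ?_
  have h := geoTo_isGeodesic y z
  rw [IsGeodesic, geoTo_zero, geoTo_one] at h
  exact h

theorem zero_smul_dirTo (y z : Y) : (0 : ℝ≥0) • dirTo y z = 0 := zero_smul_ofGeo _

theorem norm_smul_dirTo (c : ℝ≥0) (y z : Y) : norm (c • dirTo y z) = c * dist y z := by
  rw [dirTo, norm_smul_ofGeo, ← dirTo, norm_dirTo]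

theorem inner_smul_dirTo {y : Y} (v : TangentCone y) (c : ℝ≥0) (z : Y) :
    inner v (c • dirTo y z) = c * inner v (dirTo y z) := inner_smul_ofGeo v c _

theorem dist_dirTo_le (y z z' : Y) : dist (dirTo y z) (dirTo y z') ≤ dist z z' := by
  rw [dirTo, dirTo, dist_ofGeo]
  refine Geo.dist_le_of_eventually ?_
  filter_upwards [Ioo_mem_nhdsGT one_pos] with t ht
  rw [Geo.quot, div_le_iff₀ ht.1]
  have := (geoTo_isGeodesic y z).dist_le (geoTo_isGeodesic y z')
    (by rw [geoTo_zero, geoTo_zero]) ⟨ht.1.le, ht.2.le⟩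
  rw [geoTo_one, geoTo_one] at this
  linarith

theorem continuous_dirTo (y : Y) : Continuous (dirTo y) :=
  (LipschitzWith.of_dist_le_mul (K := 1) fun z z' => by
    simpa using dist_dirTo_le y z z').continuous

/-- By uniqueness, $\gamma$ restricted to $[0,1/n]$ and rescaled is the geodesic to $\gamma_{1/n}$;
multiplication by $n$ undoes the rescaling. -/
theorem eventually_ofGeo_eq {y : Y} (γ : Geo y) :
    ∀ᶠ n : ℕ in atTop, ofGeo γ = (n : ℝ≥0) • dirTo y (γ.toFun (1 / n)) := by
  obtain ⟨ε, hε, k, -, h⟩ := γ.isGeodesic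
  filter_upwards [eventually_gt_atTop 0,
    (tendsto_one_div_atTop_nhds_zero_nat (𝕜 := ℝ)).eventually (gt_mem_nhds hε)] with n hn hnε
  have hn' : (0 : ℝ) < n := Nat.cast_pos.2 hn
  rw [dirTo, smul_ofGeo]
  refine ofGeo_eq_ofGeo (Geo.dist_eq_of_tendsto (tendsto_const_nhds.congr' ?_))
  have hmem : ∀ s ∈ Icc (0 : ℝ) 1, s / n ∈ Icc (0 : ℝ) ε := fun s hs =>
    ⟨div_nonneg hs.1 hn'.le, ((div_le_div_iff_of_pos_right hn').2 hs.2).trans hnε.le⟩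
  have hgeo : IsGeodesic fun s => γ.toFun (s / n) := by
    intro s hs t ht
    rw [h _ (hmem s hs) _ (hmem t ht), h _ (hmem 1 (by simp)) _ (hmem 0 (by simp)),
      ← sub_div, abs_div, abs_of_pos hn', zero_div, zero_sub, abs_neg, abs_div, abs_of_pos hn',
      abs_one]
    ring
  filter_upwards [Ioo_mem_nhdsGT (show (0 : ℝ) < 1 / n by positivity)] with t ht
  have h1 : (n : ℝ) * t ∈ Icc (0 : ℝ) 1 :=
    ⟨by have := ht.1; positivity, by have := (lt_div_iff₀ hn').1 ht.2; linarith⟩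
  have h2 := hgeo.eq_geoTo h1
  rw [zero_div, γ.map_zero] at h2
  rw [mul_div_cancel_left₀ _ hn'.ne'] at h2
  simp only [Geo.quot, Geo.smul_toFun, NNReal.coe_natCast, ← h2, dist_self, zero_div]

/-- Replacing $\gamma_{1/n}$ by $z_i$ costs at most $n\,d(\gamma_{1/n},z_i)$. Having this for all
large $n$ lets $n$ itself be the scale in the final approximation. -/
theorem eventually_exists_dist_lt {ι : Type*} {z : ι → Y} (hz : DenseRange z) {y : Y}
    (v : TangentCone y) {δ : ℝ} (hδ : 0 < δ) :
    ∀ᶠ n : ℕ in atTop, ∃ i, dist v ((n : ℝ≥0) • dirTo y (z i)) < δ := by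
  obtain ⟨γ, hγ⟩ := denseRange_ofGeo.exists_dist_lt v (half_pos hδ)
  filter_upwards [eventually_ofGeo_eq γ, eventually_gt_atTop 0] with n hn hn0
  have hn' : (0 : ℝ) < n := Nat.cast_pos.2 hn0
  obtain ⟨i, hi⟩ := hz.exists_dist_lt (γ.toFun (1 / n)) (show 0 < δ / 2 / n by positivity)
  refine ⟨i, ?_⟩
  have h1 : dist (ofGeo γ) ((n : ℝ≥0) • dirTo y (z i)) ≤ n * dist (γ.toFun (1 / n)) (z i) := by
    rw [hn]
    refine (dist_smul_ofGeo_le _ _ _).trans ?_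
    rw [NNReal.coe_natCast]
    exact mul_le_mul_of_nonneg_left (dist_dirTo_le _ _ _) hn'.le
  have h2 := (lt_div_iff₀ hn').1 hi
  have h3 := dist_triangle v (ofGeo γ) ((n : ℝ≥0) • dirTo y (z i))
  linarith

/-- The norm of a tangent vector is the supremum of its scalar products with the unit vectors
pointing to the elements of a dense family. -/
theorem isLUB_inner_div {ι : Type*} {z : ι → Y} (hz : DenseRange z) {y : Y}
    (v : TangentCone y) :
    IsLUB {a | ∃ i, inner v (dirTo y (z i)) / dist y (z i) = a} (norm v) := by
  have hv := norm_nonneg v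
  refine ⟨?_, fun b hb => ?_⟩
  · rintro _ ⟨i, rfl⟩
    refine div_le_of_le_mul₀ dist_nonneg hv ?_
    rw [← norm_dirTo]
    exact inner_le_norm_mul_norm _ _
  · have hle : ∀ (n : ℕ) i, inner v ((n : ℝ≥0) • dirTo y (z i))
        ≤ b * norm ((n : ℝ≥0) • dirTo y (z i)) := by
      intro n i
      rw [inner_smul_dirTo, norm_smul_dirTo, mul_left_comm]
      refine mul_le_mul_of_nonneg_left ?_ NNReal.zero_le_coe
      have := hb ⟨i, rfl⟩
      -- If $z_i=y$ the quotient is the default value $0$ and carries no information; Cauchy–Schwarz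
      -- suffices.
      rcases eq_or_lt_of_le (dist_nonneg (x := y) (y := z i)) with h0 | h0
      · have h1 := inner_le_norm_mul_norm v (dirTo y (z i))
        rw [norm_dirTo, ← h0, mul_zero] at h1
        rwa [← h0, mul_zero]
      · exact (div_le_iff₀ h0).1 this
    -- The inequality is closed in its second vector, so it passes from the dense multiples to $v$.
    have hlim : inner v v ≤ b * norm v := by
      have hclosed : IsClosed {w : TangentCone y | inner v w ≤ b * norm w} :=
        isClosed_le (continuous_inner.comp (continuous_const.prodMk continuous_id))
          (continuous_const.mul continuous_norm)
      refine hclosed.closure_subset (Metric.mem_closure_iff.2 fun δ hδ => ?_)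
      obtain ⟨n, i, hi⟩ := (eventually_exists_dist_lt hz v hδ).exists
      exact ⟨_, hle n i, hi⟩
    have hvv : inner v v = norm v * norm v := by
      rw [TangentCone.inner, dist_self]; ring
    -- For $v=0$ one cannot divide by $|v|$, but every quotient in the family is $0$, so $b\ge0$.
    rcases eq_or_lt_of_le hv with h0 | h0
    · obtain ⟨i, -⟩ := hz.exists_dist_lt y one_pos
      have hv0 : v = 0 := dist_eq_zero.1 h0.symm
      refine hb ⟨i, ?_⟩
      rw [← h0, hv0, TangentCone.inner, dist_comm 0, TangentCone.norm, TangentCone.norm,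
        dist_self]
      ring
    · exact le_of_mul_le_mul_right (hvv ▸ hlim) h0

end DirTo

theorem EssSepValued.of_separableSpace {α Y : Type*} [MeasurableSpace α] [MetricSpace Y]
    [TopologicalSpace.SeparableSpace Y] (μ : Measure α) (v : α → Y) : EssSepValued μ v :=
  ⟨univ, TopologicalSpace.isSeparable_univ_iff.2 inferInstance, by simp⟩

theorem distL2_zero_right {α Y : Type*} [MeasurableSpace α] [MetricSpace Y] {u : α → Y}
    (μ : Measure α) (S : BdlSection u) :
    distL2 μ S (fun _ => 0) =
      (∫⁻ x, ENNReal.ofReal (TangentCone.norm (S x) ^ 2) ∂μ) ^ (1 / 2 : ℝ) := rfl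

/-! ### Borel sections and the class 𝓛² -/

section Measurability

variable {α Y : Type*} [MeasurableSpace α] [MetricSpace Y] [CAT0Space Y] [MeasurableSpace Y]

theorem TangentBdl.measurable_inner_dirTo (z : Y) :
    Measurable fun p : TangentBdl Y => TangentCone.inner p.vec (dirTo p.base z) := by
  refine Measurable.mono (comap_measurable _) ?_ (BorelSpace.measurable_eq (α := ℝ)).le
  exact (le_iSup (fun z : Y => MeasurableSpace.comap
    (fun p : TangentBdl Y => TangentCone.inner p.vec (dirTo p.base z)) (borel ℝ)) z).trans
    le_sup_right

theorem PullbackBdl.measurable_snd {u : α → Y} :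
    Measurable fun p : PullbackBdl u => (p.1.2 : TangentBdl Y) :=
  Measurable.comp (f := fun p : {p : α × TangentBdl Y // p.2.base = u p.1} => p.1)
    _root_.measurable_snd measurable_subtype_coe

/-- The remaining generators of the σ-algebra only involve $x$ and $u(x)$, which are measurable
anyway. -/
theorem isBorelSection_iff {u : α → Y} (hu : Measurable u) {T : BdlSection u} :
    IsBorelSection T ↔ ∀ z, Measurable fun x => TangentCone.inner (T x) (dirTo (u x) z) := by
  constructor
  · intro h z
    have h2 := PullbackBdl.measurable_snd.comp h
    have h3 := (TangentBdl.measurable_inner_dirTo z).comp h2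
    exact h3
  · intro h
    have h2 : Measurable fun x => (⟨u x, T x⟩ : TangentBdl Y) := by
      rw [measurable_iff_le_map]
      refine sup_le ?_ (iSup_le fun z => ?_)
      · exact MeasurableSpace.comap_le_iff_le_map.2 (measurable_iff_le_map.1 hu)
      · have hz := measurable_iff_le_map.1 (h z)
        rw [BorelSpace.measurable_eq (α := ℝ)] at hz
        exact MeasurableSpace.comap_le_iff_le_map.2 hz
    exact Measurable.subtype_mk (measurable_id.prodMk h2)

variable [TopologicalSpace.SeparableSpace Y] [BorelSpace Y] {u : α → Y} {T : BdlSection u}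

theorem IsBorelSection.measurable_norm (hu : Measurable u) (hT : IsBorelSection T) :
    Measurable fun x => TangentCone.norm (T x) := by
  have : SecondCountableTopology Y := UniformSpace.secondCountable_of_separable Y
  rcases isEmpty_or_nonempty α with _ | ⟨⟨x₀⟩⟩
  · exact measurable_of_empty _
  have : Nonempty Y := ⟨u x₀⟩
  exact Measurable.isLUB (fun i =>
    ((isBorelSection_iff hu).1 hT (TopologicalSpace.denseSeq Y i)).div
    (hu.dist measurable_const)) fun x =>
      isLUB_inner_div (TopologicalSpace.denseRange_denseSeq Y) (T x)

/-- A Carathéodory function, continuous in the target $z$ and measurable in $x$, is jointly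
measurable and can be evaluated at $z=v(x)$. -/
theorem IsBorelSection.measurable_inner (hu : Measurable u) (hT : IsBorelSection T) {v : α → Y}
    (hv : Measurable v) : Measurable fun x => TangentCone.inner (T x) (dirTo (u x) (v x)) := by
  have : SecondCountableTopology Y := UniformSpace.secondCountable_of_separable Y
  have h := measurable_uncurry_of_continuous_of_measurable
    (u := fun (z : Y) (x : α) => TangentCone.inner (T x) (dirTo (u x) z))
    (fun x => TangentCone.continuous_inner.comp (continuous_const.prodMk (continuous_dirTo (u x))))
    ((isBorelSection_iff hu).1 hT)
  have h2 := h.comp (hv.prodMk measurable_id)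
  exact h2

theorem IsBorelSection.measurable_dist (hu : Measurable u) (hT : IsBorelSection T) (c : ℝ≥0)
    {v : α → Y} (hv : Measurable v) : Measurable fun x => dist (T x) (dirSection u c v x) := by
  have : SecondCountableTopology Y := UniformSpace.secondCountable_of_separable Y
  have h : (fun x => dist (T x) (dirSection u c v x)) = fun x => Real.sqrt
      (TangentCone.norm (T x) ^ 2 + (c * dist (u x) (v x)) ^ 2
        - 2 * (c * TangentCone.inner (T x) (dirTo (u x) (v x)))) := by
    funext x
    rw [← norm_smul_dirTo, ← inner_smul_dirTo, ← TangentCone.dist_sq,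
      Real.sqrt_sq dist_nonneg, dirSection]
  rw [h]
  exact ((((hT.measurable_norm hu).pow_const 2).add
    (((hu.dist hv).const_mul _).pow_const 2)).sub
      (((hT.measurable_inner hu hv).const_mul _).const_mul _)).sqrt

/-- Constant targets suffice: $c=0$ yields the norm, $c=1$ the distance to the direction, and
polarization the scalar product. -/
theorem MemCalL2.isBorelSection {μ : Measure α} (hu : Measurable u) (hT : MemCalL2 μ u T) :
    IsBorelSection T := by
  have : SecondCountableTopology Y := UniformSpace.secondCountable_of_separable Y
  have hdist : ∀ (c : ℝ≥0) (z : Y), Measurable fun x => dist (T x) (c • dirTo (u x) z) :=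
    fun c z => hT.measurable_dist c (fun _ => z) measurable_const (.of_separableSpace μ _)
  refine (isBorelSection_iff hu).2 fun z => ?_
  have h0 : Measurable fun x => TangentCone.norm (T x) := by
    simpa only [TangentCone.norm, zero_smul_dirTo] using hdist 0 z
  have h1 : Measurable fun x => dist (T x) (dirTo (u x) z) := by
    simpa only [dirTo, TangentCone.one_smul_ofGeo] using hdist 1 z
  have h2 : Measurable fun x => TangentCone.norm (dirTo (u x) z) := by
    simpa only [norm_dirTo] using hu.dist measurable_const
  exact (((h0.pow_const 2).add (h2.pow_const 2)).sub (h1.pow_const 2)).div_const 2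

/-- Fatou's lemma along the approximating sequence. -/
theorem MemCalL2.lintegral_norm_sq_lt_top {μ : Measure α} (hu : Measurable u)
    (hT : MemCalL2 μ u T) : ∫⁻ x, ENNReal.ofReal (TangentCone.norm (T x) ^ 2) ∂μ < ∞ := by
  have : SecondCountableTopology Y := UniformSpace.secondCountable_of_separable Y
  obtain ⟨c, v, hv, hsup, hlim⟩ := hT.exists_seq
  have hmeas : ∀ n, Measurable fun x =>
      ENNReal.ofReal (TangentCone.norm (dirSection u (c n) (v n) x) ^ 2) := by
    intro n
    simp only [dirSection, norm_smul_dirTo]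
    exact (((hu.dist (hv n).1).const_mul _).pow_const 2).ennreal_ofReal
  have hpt : ∀ x, liminf (fun n =>
      ENNReal.ofReal (TangentCone.norm (dirSection u (c n) (v n) x) ^ 2)) atTop
      = ENNReal.ofReal (TangentCone.norm (T x) ^ 2) := fun x =>
    (ENNReal.tendsto_ofReal (((TangentCone.continuous_norm.tendsto _).comp
      (tendsto_iff_dist_tendsto_zero.2 (hlim x))).pow 2)).liminf_eq
  have hle := lintegral_liminf_le (μ := μ) (u := atTop) hmeas
  simp only [hpt] at hle
  set M := ⨆ n, distL2 μ (dirSection u (c n) (v n)) (fun _ => 0)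
  have hM : ∀ n, ∫⁻ x, ENNReal.ofReal (TangentCone.norm (dirSection u (c n) (v n) x) ^ 2) ∂μ
      ≤ M ^ (2 : ℝ) := by
    intro n
    have h := ENNReal.rpow_le_rpow (le_iSup (fun n =>
      distL2 μ (dirSection u (c n) (v n)) (fun _ => 0)) n) (zero_le_two (α := ℝ))
    rw [distL2_zero_right, ← ENNReal.rpow_mul] at h
    norm_num at h
    simpa using h
  refine (hle.trans ((liminf_le_liminf (Eventually.of_forall hM)).trans_eq (liminf_const _))).trans_lt

    (ENNReal.rpow_lt_top_of_nonneg zero_le_two hsup.ne)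

/-- A Borel section is the pointwise limit of sections of the form `n • (G_u^{v_n})'_0` whose norms
are controlled by the norm of the section. -/
theorem IsBorelSection.exists_approx (hu : Measurable u) (hT : IsBorelSection T) :
    ∃ v : ℕ → α → Y, (∀ n, Measurable (v n)) ∧
      (∀ (n : ℕ) x, TangentCone.norm (dirSection u n (v n) x) ≤ 3 * TangentCone.norm (T x)) ∧
      ∀ x, Tendsto (fun n : ℕ => dist (dirSection u n (v n) x) (T x)) atTop (𝓝 0) := by
  classical
  rcases isEmpty_or_nonempty α with _ | ⟨⟨x₀⟩⟩
  · exact ⟨fun _ => isEmptyElim, fun _ => measurable_of_empty _, fun _ => isEmptyElim, isEmptyElim⟩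
  have : Nonempty Y := ⟨u x₀⟩
  set z := TopologicalSpace.denseSeq Y
  have hz : DenseRange z := TopologicalSpace.denseRange_denseSeq Y
  let D : ℕ → ℕ → α → ℝ := fun n k x => dist (T x) ((n : ℝ≥0) • dirTo (u x) (z k))
  have hD : ∀ n k, Measurable (D n k) := fun n k => hT.measurable_dist hu n measurable_const
  let I : ℕ → α → ℝ := fun n x => ⨅ k, D n k x
  have hI : ∀ n, Measurable (I n) := fun n => Measurable.iInf (hD n)
  have hbdd : ∀ n x, BddBelow (range fun k => D n k x) := fun n x =>
    ⟨0, by rintro _ ⟨k, rfl⟩; exact dist_nonneg⟩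
  have hI0 : ∀ n x, 0 ≤ I n x := fun n x => Real.iInf_nonneg fun k => dist_nonneg
  -- A point $z_k$ close to $u(x)$ gives an almost zero vector, at distance about $|T_x|$ from
  -- $T_x$.
  have hIT : ∀ n x, I n x ≤ TangentCone.norm (T x) := by
    intro n x
    refine le_of_forall_pos_le_add fun δ hδ => ?_
    obtain ⟨k, hk⟩ := hz.exists_dist_lt (u x) (show 0 < δ / (n + 1) by positivity)
    have h1 : TangentCone.norm ((n : ℝ≥0) • dirTo (u x) (z k)) ≤ δ := by
      rw [norm_smul_dirTo, NNReal.coe_natCast]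
      rw [lt_div_iff₀ (by positivity)] at hk
      nlinarith [dist_nonneg (x := u x) (y := z k)]
    have h2 : D n k x ≤ TangentCone.norm (T x) + TangentCone.norm ((n : ℝ≥0) • dirTo (u x) (z k)) :=
      dist_triangle_right _ _ _
    linarith [ciInf_le (hbdd n x) k]
  have hIlim : ∀ x, Tendsto (fun n => I n x) atTop (𝓝 0) := by
    intro x
    refine Metric.tendsto_nhds.2 fun δ hδ => ?_
    filter_upwards [eventually_exists_dist_lt hz (T x) hδ] with n ⟨k, hk⟩
    rw [Real.dist_0_eq_abs, abs_of_nonneg (hI0 n x)]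
    exact (ciInf_le (hbdd n x) k).trans_lt hk
  let f : ℕ → α → Y
    | 0 => u
    | k + 1 => fun _ => z k
  -- Where $T_x\ne0$, some $z_k$ comes within $|T_x|/(n+1)$ of the infimum. Where $T_x=0$ this
  -- margin vanishes, so index $0$ is reserved for the exact choice $u(x)$, whose direction is zero.
  -- Taking the first admissible index keeps the selection measurable.
  let p : ℕ → ℕ → α → Prop
    | _, 0, x => TangentCone.norm (T x) = 0
    | n, k + 1, x => D n k x < I n x + TangentCone.norm (T x) / (n + 1)
  have hnorm := hT.measurable_norm hu
  have hf : ∀ k, Measurable (f k) := by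
    rintro (_ | k)
    exacts [hu, measurable_const]
  have hp : ∀ n k, MeasurableSet {x | p n k x} := by
    rintro n (_ | k)
    · exact measurableSet_eq_fun hnorm measurable_const
    · exact measurableSet_lt (hD n k) ((hI n).add (hnorm.div_const _))
  have hex : ∀ n x, ∃ k, p n k x := by
    intro n x
    rcases eq_or_lt_of_le (TangentCone.norm_nonneg (T x)) with h | h
    · exact ⟨0, h.symm⟩
    · obtain ⟨k, hk⟩ := exists_lt_of_ciInf_lt
        (show (⨅ k, D n k x) < I n x + TangentCone.norm (T x) / (n + 1) from
          lt_add_of_pos_right _ (by positivity))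
      exact ⟨k + 1, hk⟩
  let v : ℕ → α → Y := fun n x => f (Nat.find (hex n x)) x
  have hdist : ∀ (n : ℕ) x, dist (dirSection u n (v n) x) (T x) ≤
      I n x + TangentCone.norm (T x) / (n + 1) := by
    intro n x
    have hspec := Nat.find_spec (hex n x)
    change dist ((n : ℝ≥0) • dirTo (u x) (f (Nat.find (hex n x)) x)) (T x) ≤ _
    generalize Nat.find (hex n x) = k at hspec ⊢
    rw [dist_comm]
    rcases k with _ | k
    · have h0 : TangentCone.norm (T x) = 0 := hspec
      have h1 : TangentCone.norm ((n : ℝ≥0) • dirTo (u x) (u x)) = 0 := by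
        rw [norm_smul_dirTo, dist_self, mul_zero]
      have h2 := dist_triangle_right (T x) ((n : ℝ≥0) • dirTo (u x) (u x)) 0
      change _ ≤ TangentCone.norm _ + TangentCone.norm _ at h2
      rw [h0, h1] at h2
      rw [h0, zero_div]
      exact h2.trans (by linarith [hI0 n x])
    · exact le_of_lt hspec
  refine ⟨v, fun n => Measurable.find (p := p n) hf (hp n) (hex n), fun n x => ?_, fun x => ?_⟩
  · have h1 := dist_triangle (dirSection u n (v n) x) (T x) 0
    change TangentCone.norm _ ≤ _ + TangentCone.norm _ at h1
    have h2 : TangentCone.norm (T x) / (n + 1) ≤ TangentCone.norm (T x) :=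
      div_le_self (TangentCone.norm_nonneg _) (by linarith [Nat.cast_nonneg (α := ℝ) n])
    linarith [hdist n x, hIT n x]
  · refine squeeze_zero (fun n => dist_nonneg) (fun n => hdist n x) ?_
    have h := (tendsto_one_div_add_atTop_nhds_zero_nat (𝕜 := ℝ)).const_mul (TangentCone.norm (T x))
    have h2 := (hIlim x).add h
    rw [mul_zero, add_zero] at h2
    simpa only [mul_one_div] using h2

theorem IsBorelSection.memCalL2 {μ : Measure α} (hu : Measurable u) (hT : IsBorelSection T)
    (hfin : ∫⁻ x, ENNReal.ofReal (TangentCone.norm (T x) ^ 2) ∂μ < ∞) : MemCalL2 μ u T := by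
  obtain ⟨v, hv, hle, hlim⟩ := hT.exists_approx hu
  refine ⟨fun c v hv _ => hT.measurable_dist hu c hv, fun n => n, v,
    fun n => ⟨hv n, .of_separableSpace μ _⟩, ?_, hlim⟩
  refine (iSup_le fun n => ?_).trans_lt (ENNReal.rpow_lt_top_of_nonneg
    (show (0 : ℝ) ≤ 1 / 2 by norm_num) (ENNReal.mul_lt_top ENNReal.ofReal_lt_top hfin).ne
      -- $9=3^2$, from the pointwise bound by $3|T_x|$.
      (x := ENNReal.ofReal 9 * ∫⁻ x, ENNReal.ofReal (TangentCone.norm (T x) ^ 2) ∂μ))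
  rw [distL2_zero_right]
  refine ENNReal.rpow_le_rpow ?_ (by norm_num)
  rw [← lintegral_const_mul' _ _ ENNReal.ofReal_ne_top]
  refine lintegral_mono fun x => ?_
  rw [← ENNReal.ofReal_mul (by norm_num)]
  refine ENNReal.ofReal_le_ofReal ?_
  have := pow_le_pow_left₀ (TangentCone.norm_nonneg _) (hle n x) 2
  linarith

theorem memCalL2_iff {μ : Measure α} (hu : Measurable u) :
    MemCalL2 μ u T ↔
      IsBorelSection T ∧ ∫⁻ x, ENNReal.ofReal (TangentCone.norm (T x) ^ 2) ∂μ < ∞ :=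
  ⟨fun h => ⟨h.isBorelSection hu, h.lintegral_norm_sq_lt_top hu⟩, fun h => h.1.memCalL2 hu h.2⟩

end Measurability

/-! ### Passage to equivalence classes -/

theorem L2.toAE_injective {α Y : Type*} [MeasurableSpace α] [MetricSpace Y] [CAT0Space Y]
    [MeasurableSpace Y] (μ : Measure α) (u : α → Y) : Function.Injective (L2.toAE μ u) := by
  intro S T
  induction S using Quotient.inductionOn with | _ S
  induction T using Quotient.inductionOn with | _ T
  intro h
  exact Quotient.sound ((S.2.distL2_eq_zero_iff T.2).2 ((AESection.mk_eq_mk μ S.1 T.1).1 h))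

theorem L2.mem_range_toAE {α Y : Type*} [MeasurableSpace α] [MetricSpace Y] [CAT0Space Y]
    [MeasurableSpace Y] {μ : Measure α} {u : α → Y} {S : AESection μ u} :
    S ∈ range (L2.toAE μ u) ↔ ∃ T : BdlSection u, MemCalL2 μ u T ∧ S = AESection.mk μ T := by
  constructor
  · rintro ⟨T, rfl⟩
    induction T using Quotient.inductionOn with | _ T
    exact ⟨T.1, T.2, rfl⟩
  · rintro ⟨T, hT, rfl⟩
    exact ⟨Quotient.mk _ ⟨T, hT⟩, rfl⟩

end GeomTangent

theorem mainTheorem7 {X Y : Type*}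
    [MetricSpace X] [CompleteSpace X] [TopologicalSpace.SeparableSpace X]
    [MeasurableSpace X] [BorelSpace X]
    (m : MeasureTheory.Measure X)
    (hm : ∀ s : Set X, Bornology.IsBounded s → m s < ⊤)
    [MetricSpace Y] [TopologicalSpace.SeparableSpace Y] [GeomTangent.CAT0Space Y]
    [MeasurableSpace Y] [BorelSpace Y]
    (Ω : Set X) (hΩ : IsOpen Ω) (u : Ω → Y) (hu : Measurable u) :
    Function.Injective
        (GeomTangent.L2.toAE (m.comap (Subtype.val : Ω → X)) u) ∧
      ∀ S : GeomTangent.AESection (m.comap (Subtype.val : Ω → X)) u,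
        S ∈ Set.range (GeomTangent.L2.toAE (m.comap (Subtype.val : Ω → X)) u) ↔
          ∃ T : GeomTangent.BdlSection u,
            GeomTangent.IsBorelSection T ∧
            (∫⁻ x, ENNReal.ofReal ((T x).norm ^ 2) ∂(m.comap (Subtype.val : Ω → X))) < ⊤ ∧
            S = GeomTangent.AESection.mk (m.comap (Subtype.val : Ω → X)) T := by
  refine ⟨GeomTangent.L2.toAE_injective _ u, fun S => ?_⟩
  simp only [GeomTangent.L2.mem_range_toAE, GeomTangent.memCalL2_iff hu, and_assoc]
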